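/- Let $\beta\approx 0.745$ be the Kertz bound, i.e. the solution $\beta\in(0,1)$ of $$\int_0^1\frac{dy}{(\beta^{-1}-1)-y(\log y-1)}=1 .$$ For a collection $\mathbf X=\{X_1,\dots,X_n\}$ of independent non-negative real random variables with finite expectations, let $\mathsf{OPT}(\mathbf X)$ be the supremum of the expected reward $\mathbb E[X_{\pi(\tau)}]$ when the variables arrive in a uniformly random order $\pi$, independent of $\mathbf X$; here $\tau$ ranges over the stopping rules that decide at each step $k$ from the identities and values $(\pi(j),X_{\pi(j)})$, $j\le k$, seen so far (the reward is $0$ if nothing is accepted). For a subcollection $\mathbf X'$ let $\mathsf{MAX}(\mathbf X')=\mathbb E[\max_{X\in\mathbf X'}X]$ (with value $0$ for the empty collection). Then for every real $\alpha>\beta$ and every positive integer $r$ there is an $N$ such that for every $n\ge N$ there exists a collection $\mathbf X=\{X_1,\dots,X_n\}$ of $n$ independent non-negative random variables with finite expectations such that, for every subcollection $\mathbf X'$ of $\mathbf X$ containing exactly $n-r$ of these variables, $$\mathsf{OPT}(\mathbf X)<\alpha\cdot\mathsf{MAX}(\mathbf X').$$ -/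

import Mathlib

open MeasureTheory ProbabilityTheory

/-- `β` is the Kertz bound (`β ≈ 0.745`): the solution of
`∫₀¹ [(β⁻¹ - 1) - y (log y - 1)]⁻¹ dy = 1`. -/
def IsKertzBound (β : ℝ) : Prop :=
  0 < β ∧ β < 1 ∧
    ∫ y in (0 : ℝ)..1, ((β⁻¹ - 1) - y * (Real.log y - 1))⁻¹ = 1

/-- A prophet-inequality instance: `n` independent non-negative real random variables
with finite expectations. -/
structure ProphetInstance (n : ℕ) where
  /-- The underlying sample space. -/
  Ω : Type
  /-- Its events. -/
  mΩ : MeasurableSpace Ω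
  /-- Its probability measure. -/
  P : Measure Ω
  isProb : IsProbabilityMeasure P
  /-- `X i` is the value inside box `i`. -/
  X : Fin n → Ω → ℝ
  measurable_X : ∀ i, Measurable (X i)
  indep_X : iIndepFun X P
  nonneg_X : ∀ i ω, 0 ≤ X i ω
  integrable_X : ∀ i, Integrable (X i) P

namespace ProphetInstance

/-- Every set of arrival orders is measurable. -/
instance instMeasurableSpacePerm (n : ℕ) : MeasurableSpace (Equiv.Perm (Fin n)) := ⊤

instance instMeasurableSpaceΩ {n : ℕ} (I : ProphetInstance n) : MeasurableSpace I.Ω := I.mΩ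

instance instIsProbabilityMeasureP {n : ℕ} (I : ProphetInstance n) : IsProbabilityMeasure I.P :=
  I.isProb

/-- The sample space of the random-order problem: the values inside the boxes, together with
an arrival order `π`, where `π k` is the box that arrives at step `k`. -/
abbrev Sample {n : ℕ} (I : ProphetInstance n) : Type := I.Ω × Equiv.Perm (Fin n)

/-- The arrival order is uniformly random and independent of the values in the boxes. -/
noncomputable def law {n : ℕ} (I : ProphetInstance n) : Measure I.Sample :=
  I.P.prod (uniformOn (Set.univ : Set (Equiv.Perm (Fin n))))

/-- What is seen at step `k`: the identity of the arriving box and the value inside it. -/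
def observation {n : ℕ} (I : ProphetInstance n) (k : Fin n) (p : I.Sample) : Fin n × ℝ :=
  (p.2 k, I.X (p.2 k) p.1)

theorem measurable_observation {n : ℕ} (I : ProphetInstance n) (k : Fin n) :
    Measurable (I.observation k) := by
  have : DiscreteMeasurableSpace (Equiv.Perm (Fin n)) := ⟨fun _ => trivial⟩
  refine measurable_from_prod_countable_left fun π => ?_
  exact (measurable_const (a := π k)).prodMk (I.measurable_X (π k))

/-- The information available after step `k`: all that was seen at the steps `j ≤ k`. -/
def history {n : ℕ} (I : ProphetInstance n) :
    Filtration (Fin n) (inferInstance : MeasurableSpace I.Sample) where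
  seq k := ⨆ j ≤ k, MeasurableSpace.comap (I.observation j) inferInstance
  mono' _ _ h := iSup₂_le fun j hj => le_iSup₂_of_le j (hj.trans h) le_rfl
  le' _ := iSup₂_le fun j _ => (I.measurable_observation j).comap_le

/-- The reward of the stopping rule `τ`: the value in the box that arrives at step `τ`, and `0`
if no box is accepted (`τ = ⊤`). -/
def reward {n : ℕ} (I : ProphetInstance n) (τ : I.Sample → WithTop (Fin n)) (p : I.Sample) : ℝ :=
  match τ p with
  | ⊤ => 0
  | (k : Fin n) => I.X (p.2 k) p.1

/-- `OPT(X)`: the optimal expected reward of a stopping rule when the boxes arrive in uniformly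
random order. A stopping rule decides at each step from what has been seen so far. -/
noncomputable def OPT {n : ℕ} (I : ProphetInstance n) : ℝ :=
  sSup {v : ℝ | ∃ τ : I.Sample → WithTop (Fin n),
    IsStoppingTime I.history τ ∧ v = ∫ p, I.reward τ p ∂I.law}

/-- `MAX(X')` for the subcollection `X' = {X i | i ∈ S}`: the expectation of its maximum. -/
noncomputable def MAX {n : ℕ} (I : ProphetInstance n) (S : Finset (Fin n)) : ℝ :=
  ∫ ω, ⨆ i : S, I.X i ω ∂I.P

end ProphetInstance

/-! The hard instance is i.i.d., so the arrival order is irrelevant and only the number of boxes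
still to come matters. Given `q k` in `[0, 1]` and weights `w k = q 0 * ... * q (k - 1)`, each box
has an independent uniform `u` and pays `w k` for every `k < n` with `u < 1 - q k`, plus a rare
jackpot `w n / δ` when `u < δ`. With `v j = ∑ k < j, w k`, the first `j` levels pay at most `v j`,
so the mean excess of a box over `v j` is at most `∑ k ∈ [j, n), w k * (1 - q k) + w n`. This
telescopes to `w j = v (j + 1) - v j`, and the dynamic program gives `OPT ≤ v n` (`OPT_le`,
`exists_instance_of_weights`).

The box with the smallest `u` collects every level collected by any box. Hence the maximum of `m = n
- r` boxes has mean at least about `∑ w k * (1 - q k ^ m) + m * w n`. It remains to choose `q` so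
that this is nearly `β⁻¹ * ∑ w k`.

Put `q k = y ^ (1 / m)` with `y` running along an Euler scheme for `y' = c - y * (log y - 1)`, `c =
β⁻¹ - 1`. To first order `m * (q k * y_next - y) = y + c`, so `∑ w k * (y + c)` telescopes to at
most `m * w n` (`kertz_step`, `exists_kertz_weights`). The Kertz equation says that the exact flow
takes time 1 from 0 to 1; the Euler scheme lags behind and stays in `[0, 1]`. Removing `r` boxes
costs a relative error of order `(r + log n) / n`. -/

namespace ProphetInstance

/-! ### Upper bound on `OPT` by dynamic programming -/

variable {n : ℕ} (I : ProphetInstance n)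

/-- Stopping at step `k` never beats the thresholds `v (n - (j + 1))` by more than the excesses
over them at the steps up to `k`. -/
theorem add_le_add_sum_excess (v : ℕ → ℝ) (d : Fin n → ℝ) (hd : ∀ j, 0 ≤ d j) (k : Fin n) :
    v (n - (k + 1)) + d k ≤
      v n + ∑ j : Fin n, if j ≤ k then d j - (v (n - j) - v (n - (j + 1))) else 0 := by
  have h1 : ∑ j : Fin n, (if j ≤ k then v (n - j) - v (n - (j + 1)) else 0)
      = v n - v (n - (k + 1)) := by
    have := Fin.sum_univ_eq_sum_range
      (fun j => if j ≤ (k : ℕ) then v (n - j) - v (n - (j + 1)) else 0) n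
    simp only [Fin.val_fin_le] at this
    rw [this, ← Finset.sum_filter,
      show (Finset.range n).filter (· ≤ (k : ℕ)) = Finset.range (k + 1) by
        ext j; have := k.2; simp; omega]
    simpa using Finset.sum_range_sub' (fun j => v (n - j)) (k + 1)
  have h2 : d k ≤ ∑ j : Fin n, if j ≤ k then d j else 0 := by
    have := Finset.single_le_sum (f := fun j : Fin n => if j ≤ k then d j else 0)
      (fun j _ => by split_ifs <;> simp [hd]) (Finset.mem_univ k)
    simpa using this
  have h3 : ∑ j : Fin n, (if j ≤ k then d j - (v (n - j) - v (n - (j + 1))) else 0)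
      = (∑ j : Fin n, if j ≤ k then d j else 0) -
        ∑ j : Fin n, (if j ≤ k then v (n - j) - v (n - (j + 1)) else 0) := by
    rw [← Finset.sum_sub_distrib]
    exact Finset.sum_congr rfl fun j _ => by split_ifs <;> simp
  rw [h3, h1]; linarith

theorem reward_nonneg (τ : I.Sample → WithTop (Fin n)) (p : I.Sample) : 0 ≤ I.reward τ p := by
  unfold reward
  split
  · exact le_rfl
  · exact I.nonneg_X _ _

/-- A pathwise optional-stopping bound: the term of step `j` is switched on by `j ≤ τ`, which is
decided before the box of step `j` is opened. Steps count from 0, so `n - (j + 1)` boxes remain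
after step `j`. -/
theorem reward_le_add_sum_excess (v : ℕ → ℝ) (h0 : 0 ≤ v 0) (τ : I.Sample → WithTop (Fin n))
    (p : I.Sample) :
    I.reward τ p ≤ v n + ∑ j : Fin n, if (j : WithTop (Fin n)) ≤ τ p then
      max (I.X (p.2 j) p.1 - v (n - (j + 1))) 0 - (v (n - j) - v (n - (j + 1))) else 0 := by
  cases h : τ p with
  | top =>
    -- If nothing is accepted, the increments of `v` telescope to `v n - v 0`, and `0 ≤ v 0`
    -- suffices.
    simp only [reward, h, le_top, if_true, Finset.sum_sub_distrib]
    have h1 := Fin.sum_univ_eq_sum_range (fun j => v (n - j) - v (n - (j + 1))) n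
    rw [Finset.sum_range_sub' (fun j => v (n - j)) n, Finset.sum_sub_distrib] at h1
    simp only [Nat.sub_zero, Nat.sub_self] at h1
    have h2 : 0 ≤ ∑ j : Fin n, max (I.X (p.2 j) p.1 - v (n - (j + 1))) 0 :=
      Finset.sum_nonneg fun j _ => le_max_right _ _
    linarith
  | coe k =>
    simp only [reward, h, WithTop.coe_le_coe]
    refine le_trans ?_ (add_le_add_sum_excess v
      (fun j => max (I.X (p.2 j) p.1 - v (n - (j + 1))) 0) (fun j => le_max_right _ _) k)
    have := le_max_left (I.X (p.2 k) p.1 - v (n - (k + 1))) 0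
    linarith

/-- For a fixed arrival order, the decision to continue past the steps before `j` depends only on
the boxes opened at those steps. -/
theorem measurableSet_slice (τ : I.Sample → WithTop (Fin n)) (hτ : IsStoppingTime I.history τ)
    (π : Equiv.Perm (Fin n)) (j : Fin n) :
    MeasurableSet[⨆ i ∈ {i | i ≠ π j}, MeasurableSpace.comap (I.X i) inferInstance]
      {ω | (j : WithTop (Fin n)) ≤ τ (ω, π)} := by
  set m := ⨆ i ∈ {i | i ≠ π j}, MeasurableSpace.comap (I.X i) inferInstance with hm
  have key : ∀ i < j, MeasurableSet[m] {ω | τ (ω, π) ≤ (i : WithTop (Fin n))} := by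
    intro i hi
    have hle : MeasurableSpace.comap (fun ω => ((ω, π) : I.Sample)) (I.history i) ≤ m := by
      change MeasurableSpace.comap _ (⨆ l ≤ i, _) ≤ m
      simp only [MeasurableSpace.comap_iSup, MeasurableSpace.comap_comp]
      refine iSup₂_le fun l hl => ?_
      have hX : Measurable[m] (I.X (π l)) := by
        refine Measurable.mono (comap_measurable (I.X (π l))) ?_ le_rfl
        refine le_iSup₂_of_le (π l) ?_ le_rfl
        exact fun h => (hl.trans_lt hi).ne (π.injective h)
      have : Measurable[m] (I.observation l ∘ fun ω => ((ω, π) : I.Sample)) :=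
        (measurable_const (a := π l)).prodMk hX
      exact this.comap_le
    exact hle _ ⟨_, hτ i, rfl⟩
  have : {ω | (j : WithTop (Fin n)) ≤ τ (ω, π)}
      = ⋂ i : Fin n, ⋂ _ : i < j, {ω | τ (ω, π) ≤ (i : WithTop (Fin n))}ᶜ := by
    ext ω
    simp only [Set.mem_ofPred_eq, Set.mem_iInter, Set.mem_compl_iff, not_le]
    constructor
    · exact fun h i hi => (WithTop.coe_lt_coe.2 hi).trans_le h
    · intro h
      by_contra hc
      rw [not_le] at hc
      obtain ⟨i, hi⟩ := WithTop.ne_top_iff_exists.1 (ne_top_of_lt hc)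
      rw [← hi, WithTop.coe_lt_coe] at hc
      exact absurd (h i hc) (by simp [hi])
  rw [this]
  exact MeasurableSet.iInter fun i => MeasurableSet.iInter fun hi => (key i hi).compl

/-- `A` is independent of `X i`, so the integral factors as `P A` times the mean excess minus `w`.
-/
theorem setIntegral_excess_nonpos (v w : ℝ) (i : Fin n)
    (hv : ∫ ω, max (I.X i ω - v) 0 ∂I.P ≤ w) (A : Set I.Ω)
    (hA : MeasurableSet[⨆ l ∈ {l | l ≠ i}, MeasurableSpace.comap (I.X l) inferInstance] A) :
    ∫ ω in A, (max (I.X i ω - v) 0 - w) ∂I.P ≤ 0 := by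
  have hle : ∀ l, MeasurableSpace.comap (I.X l) inferInstance ≤ I.mΩ :=
    fun l => (I.measurable_X l).comap_le
  have hind := indep_iSup_of_disjoint hle ((iIndepFun_iff_iIndep _ _ _).1 I.indep_X)
    (S := {l | l ≠ i}) (T := {i}) (by simp)
  simp only [Set.mem_singleton_iff, iSup_iSup_eq_left] at hind
  have hf : Measurable fun x : ℝ => max (x - v) 0 - w := by fun_prop
  rw [Indep.setIntegral_eq_mul (f := fun x : ℝ => max (x - v) 0 - w)
    (iSup₂_le fun l _ => hle l) hind (I.measurable_X i).aemeasurable hA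
    hf.aestronglyMeasurable]
  refine mul_nonpos_of_nonneg_of_nonpos measureReal_nonneg ?_
  have hint : Integrable (fun ω => max (I.X i ω - v) 0) I.P :=
    ((I.integrable_X i).sub (integrable_const v)).pos_part
  rw [integral_sub hint (integrable_const w)]
  simpa using hv

theorem integral_reward_slice_le (v : ℕ → ℝ) (h0 : 0 ≤ v 0)
    (hv : ∀ i, ∀ j < n, ∫ ω, max (I.X i ω - v j) 0 ∂I.P ≤ v (j + 1) - v j)
    (τ : I.Sample → WithTop (Fin n)) (hτ : IsStoppingTime I.history τ)
    (π : Equiv.Perm (Fin n)) : ∫ ω, I.reward τ (ω, π) ∂I.P ≤ v n := by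
  set A : Fin n → Set I.Ω := fun j => {ω | (j : WithTop (Fin n)) ≤ τ (ω, π)} with hAdef
  have hA := I.measurableSet_slice τ hτ π
  have hAm : ∀ j, MeasurableSet (A j) := fun j =>
    (iSup₂_le fun l _ => (I.measurable_X l).comap_le :
      (⨆ i ∈ {i | i ≠ π j}, MeasurableSpace.comap (I.X i) inferInstance) ≤ I.mΩ) _ (hA j)
  set f : Fin n → I.Ω → ℝ := fun j ω =>
    max (I.X (π j) ω - v (n - (j + 1))) 0 - (v (n - j) - v (n - (j + 1))) with hf
  have hfi : ∀ j, Integrable (f j) I.P := fun j =>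
    (((I.integrable_X (π j)).sub (integrable_const _)).pos_part).sub (integrable_const _)
  have hgi : ∀ j, Integrable ((A j).indicator (f j)) I.P := fun j => (hfi j).indicator (hAm j)
  have hle : ∀ ω, I.reward τ (ω, π) ≤ v n + ∑ j, (A j).indicator (f j) ω := by
    classical
    intro ω
    refine (I.reward_le_add_sum_excess v h0 τ (ω, π)).trans_eq ?_
    simp [Set.indicator_apply, hAdef, hf]
  calc ∫ ω, I.reward τ (ω, π) ∂I.P ≤ ∫ ω, (v n + ∑ j, (A j).indicator (f j) ω) ∂I.P :=
        integral_mono_of_nonneg (.of_forall fun ω => I.reward_nonneg τ _)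
          ((integrable_const _).add (integrable_finsetSum _ fun j _ => hgi j)) (.of_forall hle)
    _ = v n + ∑ j, ∫ ω in A j, f j ω ∂I.P := by
        rw [integral_add (integrable_const _) (integrable_finsetSum _ fun j _ => hgi j),
          integral_finsetSum _ fun j _ => hgi j]
        simp [integral_indicator (hAm _)]
    _ ≤ v n := by
        have : ∑ j, ∫ ω in A j, f j ω ∂I.P ≤ 0 := by
          refine Finset.sum_nonpos fun j _ => ?_
          refine I.setIntegral_excess_nonpos _ _ (π j) ?_ _ (hA j)
          have hj := j.2
          have := hv (π j) (n - (j + 1)) (by omega)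
          rwa [show n - ((j : ℕ) + 1) + 1 = n - j by omega] at this
        linarith

/-- If `v` dominates the values of the dynamic program of the instance, then no stopping rule
earns more than `v n`. -/
theorem OPT_le (v : ℕ → ℝ) (h0 : 0 ≤ v 0) (hn : 0 ≤ v n)
    (hv : ∀ i, ∀ j < n, ∫ ω, max (I.X i ω - v j) 0 ∂I.P ≤ v (j + 1) - v j) :
    I.OPT ≤ v n := by
  refine Real.sSup_le ?_ hn
  rintro _ ⟨τ, hτ, rfl⟩
  have : DiscreteMeasurableSpace (Equiv.Perm (Fin n)) := ⟨fun _ => trivial⟩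
  have hprob : IsProbabilityMeasure (uniformOn (Set.univ : Set (Equiv.Perm (Fin n)))) :=
    isProbabilityMeasure_uniformOn Set.finite_univ Set.univ_nonempty
  by_cases hint : Integrable (I.reward τ) I.law
  · unfold law at hint ⊢
    rw [integral_prod_symm _ hint]
    calc _ ≤ ∫ _, v n ∂(uniformOn (Set.univ : Set (Equiv.Perm (Fin n)))) :=
          integral_mono Integrable.of_finite (integrable_const _)
            fun π => I.integral_reward_slice_le v h0 hv τ hτ π
      _ = v n := by simp
  -- A non-integrable reward has integral 0 by convention.
  · rw [integral_undef hint]; exact hn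

end ProphetInstance

/-! ### Kertz's differential equation and its Euler scheme -/

/-- The speed `(β⁻¹ - 1) - y (log y - 1)` of Kertz's differential equation, with `c = β⁻¹ - 1`. -/
noncomputable def kertzSpeed (c y : ℝ) : ℝ := c - y * (Real.log y - 1)

theorem continuous_kertzSpeed (c : ℝ) : Continuous (kertzSpeed c) := by
  have : kertzSpeed c = fun y => c - (y * Real.log y - y) := by
    ext y; unfold kertzSpeed; ring
  rw [this]
  exact continuous_const.sub (Real.continuous_mul_log.sub continuous_id)

/-- The derivative is `-log y ≥ 0` on `(0, 1]`; the bound `log x ≤ x - 1` at `x = b / a` replaces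
differentiation. -/
theorem kertzSpeed_mono {c a b : ℝ} (ha : 0 ≤ a) (hab : a ≤ b) (hb : b ≤ 1) :
    kertzSpeed c a ≤ kertzSpeed c b := by
  unfold kertzSpeed
  have hlb : Real.log b ≤ 0 := Real.log_nonpos (ha.trans hab) hb
  rcases ha.eq_or_lt with rfl | ha
  · nlinarith [mul_nonneg hab (neg_nonneg.2 hlb)]
  · have hb0 : 0 < b := ha.trans_le hab
    have h1 : Real.log b - Real.log a ≤ b / a - 1 := by
      rw [← Real.log_div hb0.ne' ha.ne']
      exact Real.log_le_sub_one_of_pos (div_pos hb0 ha)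
    have h2 : a * (Real.log b - Real.log a) ≤ b - a := by
      calc _ ≤ a * (b / a - 1) := mul_le_mul_of_nonneg_left h1 ha.le
        _ = b - a := by field_simp
    nlinarith [mul_nonneg (sub_nonneg.2 hab) (neg_nonneg.2 hlb)]

theorem kertzSpeed_zero (c : ℝ) : kertzSpeed c 0 = c := by simp [kertzSpeed]

theorem kertzSpeed_one (c : ℝ) : kertzSpeed c 1 = c + 1 := by simp [kertzSpeed]

theorem le_kertzSpeed {c y : ℝ} (h0 : 0 ≤ y) (h1 : y ≤ 1) : c ≤ kertzSpeed c y := by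
  simpa [kertzSpeed_zero] using kertzSpeed_mono (c := c) le_rfl h0 h1

theorem kertzSpeed_le {c y : ℝ} (h0 : 0 ≤ y) (h1 : y ≤ 1) : kertzSpeed c y ≤ c + 1 := by
  simpa [kertzSpeed_one] using kertzSpeed_mono (c := c) h0 h1 le_rfl

theorem intervalIntegrable_inv_kertzSpeed {c a b : ℝ} (hc : 0 < c) (ha : 0 ≤ a) (hab : a ≤ b)
    (hb : b ≤ 1) : IntervalIntegrable (fun y => (kertzSpeed c y)⁻¹) volume a b := by
  refine ContinuousOn.intervalIntegrable ?_
  rw [Set.uIcc_of_le hab]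
  exact (continuous_kertzSpeed c).continuousOn.inv₀ fun y hy =>
    (hc.trans_le (le_kertzSpeed (ha.trans hy.1) (hy.2.trans hb))).ne'

theorem integral_inv_kertzSpeed_le {c a b : ℝ} (hc : 0 < c) (ha : 0 ≤ a) (hab : a ≤ b)
    (hb : b ≤ 1) : ∫ y in a..b, (kertzSpeed c y)⁻¹ ≤ (b - a) / kertzSpeed c a := by
  have h := intervalIntegral.integral_mono_on hab
    (intervalIntegrable_inv_kertzSpeed hc ha hab hb)
    (intervalIntegrable_const (c := (kertzSpeed c a)⁻¹)) fun y hy =>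
      inv_anti₀ (hc.trans_le (le_kertzSpeed ha (hab.trans hb)))
        (kertzSpeed_mono ha hy.1 (hy.2.trans hb))
  simpa [div_eq_mul_inv] using h

/-- The Euler scheme with step `h` for Kertz's differential equation, started at `0`. -/
noncomputable def kertzEuler (c h : ℝ) : ℕ → ℝ
  | 0 => 0
  | k + 1 => kertzEuler c h k + h * kertzSpeed c (kertzEuler c h k)

/-- The integral of `1 / speed` is the time the exact flow needs. As the speed increases with `y`,
the flow crosses each Euler step in time at most `h`. -/
theorem kertzEuler_le_one_aux {c h : ℝ} (hc : 0 < c) (hh : 0 < h)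
    (hint : ∫ y in (0 : ℝ)..1, (kertzSpeed c y)⁻¹ = 1) (k : ℕ) (hk : k * h ≤ 1) :
    0 ≤ kertzEuler c h k ∧ kertzEuler c h k ≤ 1 ∧
      ∫ y in (0 : ℝ)..(kertzEuler c h k), (kertzSpeed c y)⁻¹ ≤ k * h := by
  induction k with
  | zero => simp [kertzEuler]
  | succ k ih =>
    push_cast at hk ⊢
    obtain ⟨h0, h1, hI⟩ := ih (by linarith)
    set y := kertzEuler c h k with hy
    have hg : 0 < kertzSpeed c y := hc.trans_le (le_kertzSpeed h0 h1)
    have hstep : kertzEuler c h (k + 1) = y + h * kertzSpeed c y := rfl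
    have hadd : ∀ b, y ≤ b → b ≤ 1 → ∫ s in (0 : ℝ)..b, (kertzSpeed c s)⁻¹ ≤
        k * h + (b - y) / kertzSpeed c y := by
      intro b hb hb1
      rw [← intervalIntegral.integral_add_adjacent_intervals
        (intervalIntegrable_inv_kertzSpeed hc le_rfl h0 h1)
        (intervalIntegrable_inv_kertzSpeed hc h0 hb hb1)]
      exact add_le_add hI (integral_inv_kertzSpeed_le hc h0 hb hb1)
    have hle : y ≤ kertzEuler c h (k + 1) := by rw [hstep]; nlinarith
    -- An overshoot would let the flow reach 1 before time `(k + 1) * h ≤ 1`, contradicting `hint`.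
    have hle1 : kertzEuler c h (k + 1) ≤ 1 := by
      by_contra! hgt
      have h2 := hadd 1 h1 le_rfl
      have h3 : (1 - y) / kertzSpeed c y < h := by
        rw [div_lt_iff₀ hg]; rw [hstep] at hgt; linarith
      rw [hint] at h2
      linarith
    refine ⟨h0.trans hle, hle1, (hadd _ hle hle1).trans_eq ?_⟩
    rw [hstep]; field_simp; ring

theorem kertzEuler_mem {c : ℝ} (hc : 0 < c)
    (hint : ∫ y in (0 : ℝ)..1, (kertzSpeed c y)⁻¹ = 1) {N k : ℕ} (hN : 0 < N) (hk : k ≤ N) :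
    0 ≤ kertzEuler c (N : ℝ)⁻¹ k ∧ kertzEuler c (N : ℝ)⁻¹ k ≤ 1 := by
  have hN' : (0 : ℝ) < N := by exact_mod_cast hN
  have h := kertzEuler_le_one_aux hc (inv_pos.2 hN') hint k (by
    rw [← div_eq_mul_inv, div_le_one hN']; exact_mod_cast hk)
  exact ⟨h.1, h.2.1⟩

theorem le_kertzEuler {c : ℝ} (hc : 0 < c)
    (hint : ∫ y in (0 : ℝ)..1, (kertzSpeed c y)⁻¹ = 1) {N k : ℕ} (hN : 0 < N) (hk : k + 1 ≤ N) :
    c / N ≤ kertzEuler c (N : ℝ)⁻¹ (k + 1) := by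
  have hN' : (0 : ℝ) < N := by exact_mod_cast hN
  obtain ⟨h0, h1⟩ := kertzEuler_mem hc hint hN (by omega : k ≤ N)
  have := le_kertzSpeed (c := c) h0 h1
  change c / N ≤ _ + (N : ℝ)⁻¹ * kertzSpeed c _
  rw [div_eq_inv_mul]
  have := mul_le_mul_of_nonneg_left this (inv_nonneg.2 hN'.le)
  linarith

/-- One step of the telescoping estimate: `y` and `y'` are consecutive points of the Euler scheme
with step `1 / N`. -/
theorem kertz_step {c ε y y' : ℝ} {N m : ℕ} (hc : 0 < c) (hm : 0 < m) (hmN : m ≤ N)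
    (hε : (c + 1) * ((N - m : ℝ) + Real.log (N / c)) ≤ ε * N) (hy : c / N ≤ y) (hy1 : y ≤ 1)
    (hy' : y' = y + (N : ℝ)⁻¹ * kertzSpeed c y) :
    y + c - ε ≤ m * (y ^ (m : ℝ)⁻¹ * y' - y) := by
  have hm' : (0 : ℝ) < m := by exact_mod_cast hm
  have hmN' : (m : ℝ) ≤ N := by exact_mod_cast hmN
  have hN' : (0 : ℝ) < N := hm'.trans_le hmN'
  have hcN : 0 < c / N := div_pos hc hN'
  have hy0 : 0 < y := hcN.trans_le hy
  set g := kertzSpeed c y with hg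
  have hgc : c ≤ g := le_kertzSpeed hy0.le hy1
  have hg1 : g ≤ c + 1 := kertzSpeed_le hy0.le hy1
  have hy'0 : 0 ≤ y' := by
    rw [hy']; have := mul_nonneg (inv_nonneg.2 hN'.le) (hc.le.trans hgc); linarith
  set L := Real.log y with hL
  have hL0 : L ≤ 0 := Real.log_nonpos hy0.le hy1
  have hLN : -Real.log (N / c) ≤ L := by
    rw [← Real.log_inv, inv_div]; exact Real.log_le_log hcN hy
  have hq : 1 + L / m ≤ y ^ (m : ℝ)⁻¹ := by
    rw [Real.rpow_def_of_pos hy0, ← div_eq_mul_inv]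
    have := Real.add_one_le_exp (L / m); linarith
  have hgdef : g = c + y - y * L := by rw [hg, kertzSpeed]; ring
  have h1 : m * ((1 + L / m) * y' - y) ≤ m * (y ^ (m : ℝ)⁻¹ * y' - y) := by gcongr
  refine le_trans ?_ h1
  -- Kertz's speed is made for this: `g + y * L = c + y`. What is left is the error from `N ≠ m` and
  -- from `L * (y' - y)`.
  have h2 : m * ((1 + L / m) * y' - y) = c + y - g * ((N - m : ℝ) - L) / N := by
    have : m * ((1 + L / m) * y' - y) = m * (y' - y) + L * y' := by field_simp; ring
    rw [this, hy']
    field_simp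
    rw [hgdef]; ring
  rw [h2]
  have h3 : g * ((N - m : ℝ) - L) / N ≤ ε := by
    rw [div_le_iff₀ hN']
    refine le_trans ?_ hε
    apply mul_le_mul hg1 (by linarith) (by linarith) (by linarith)
  linarith

/-! ### Choice of the weights -/

/-- The weights `1, q 0, q 0 * q 1, …`. -/
def prodWeight (q : ℕ → ℝ) (k : ℕ) : ℝ := ∏ i ∈ Finset.range k, q i

theorem prodWeight_zero (q : ℕ → ℝ) : prodWeight q 0 = 1 := by simp [prodWeight]

theorem prodWeight_succ (q : ℕ → ℝ) (k : ℕ) : prodWeight q (k + 1) = prodWeight q k * q k :=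
  Finset.prod_range_succ _ _

theorem prodWeight_nonneg {q : ℕ → ℝ} {k : ℕ} (hq : ∀ i < k, 0 ≤ q i) : 0 ≤ prodWeight q k :=
  Finset.prod_nonneg fun i hi => hq i (Finset.mem_range.1 hi)

theorem prodWeight_le_one {q : ℕ → ℝ} {k : ℕ} (hq : ∀ i < k, 0 ≤ q i) (hq1 : ∀ i < k, q i ≤ 1) :
    prodWeight q k ≤ 1 :=
  Finset.prod_le_one (fun i hi => hq i (Finset.mem_range.1 hi))
    fun i hi => hq1 i (Finset.mem_range.1 hi)

theorem exists_kertz_weights {c ε : ℝ} {n m : ℕ} (hc : 0 < c)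
    (hint : ∫ y in (0 : ℝ)..1, (kertzSpeed c y)⁻¹ = 1) (hm : 0 < m) (hmn : m ≤ n)
    (hε : (c + 1) * (((n + 1 : ℕ) - m : ℝ) + Real.log ((n + 1 : ℕ) / c)) ≤ ε * (n + 1 : ℕ)) :
    ∃ q : ℕ → ℝ, (∀ k < n, 0 ≤ q k ∧ q k ≤ 1) ∧
      (1 + c - ε) * ∑ k ∈ Finset.range n, prodWeight q k ≤
        ∑ k ∈ Finset.range n, prodWeight q k * (1 - q k ^ m) + m * prodWeight q n := by
  have hm' : (0 : ℝ) < m := by exact_mod_cast hm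
  -- The shift by one skips the starting point 0, so that `Y k ≥ c / (n + 1)` and `log (Y k)` is at
  -- worst of order `-log n`. Reaching `Y n` then takes `n + 1` steps, hence the step size.
  set Y : ℕ → ℝ := fun k => kertzEuler c ((n + 1 : ℕ) : ℝ)⁻¹ (k + 1) with hY
  have hYmem : ∀ k ≤ n, 0 ≤ Y k ∧ Y k ≤ 1 := fun k hk =>
    kertzEuler_mem hc hint n.succ_pos (by omega)
  set q : ℕ → ℝ := fun k => Y k ^ (m : ℝ)⁻¹ with hq
  have hq01 : ∀ k < n, 0 ≤ q k ∧ q k ≤ 1 := fun k hk =>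
    ⟨Real.rpow_nonneg (hYmem k hk.le).1 _,
      Real.rpow_le_one (hYmem k hk.le).1 (hYmem k hk.le).2 (inv_nonneg.2 hm'.le)⟩
  refine ⟨q, hq01, ?_⟩
  have hw : ∀ k ≤ n, 0 ≤ prodWeight q k := fun k hk =>
    prodWeight_nonneg fun i hi => (hq01 i (by omega)).1
  have hstep : ∀ k < n, prodWeight q k * (Y k + c - ε) ≤
      m * (prodWeight q (k + 1) * Y (k + 1) - prodWeight q k * Y k) := by
    intro k hk
    have h := kertz_step (y' := Y (k + 1)) hc hm (hmn.trans n.le_succ) hε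
      (le_kertzEuler hc hint n.succ_pos (by omega : k + 1 ≤ n + 1)) (hYmem k hk.le).2 rfl
    calc _ ≤ prodWeight q k * (m * (q k * Y (k + 1) - Y k)) :=
          mul_le_mul_of_nonneg_left h (hw k hk.le)
      _ = _ := by rw [prodWeight_succ]; ring
  have hsum := Finset.sum_le_sum fun k hk => hstep k (Finset.mem_range.1 hk)
  rw [← Finset.mul_sum, Finset.sum_range_sub (fun k => prodWeight q k * Y k)] at hsum
  have hend : (prodWeight q n * Y n - prodWeight q 0 * Y 0) ≤ prodWeight q n := by
    have h1 := mul_le_mul_of_nonneg_left (hYmem n le_rfl).2 (hw n le_rfl)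
    have h2 := mul_nonneg (hw 0 n.zero_le) (hYmem 0 n.zero_le).1
    linarith
  have hend' := mul_le_mul_of_nonneg_left hend hm'.le
  have hpow : ∀ k ∈ Finset.range n, prodWeight q k * (1 - q k ^ m) =
      (1 + c - ε) * prodWeight q k - prodWeight q k * (Y k + c - ε) := by
    intro k hk
    rw [hq, Real.rpow_inv_natCast_pow (hYmem k (Finset.mem_range.1 hk).le).1 hm.ne']
    ring
  rw [Finset.sum_congr rfl hpow, Finset.sum_sub_distrib, ← Finset.mul_sum]
  linarith

theorem eventually_kertz_error (c ε : ℝ) (hc : 0 < c) (hε : 0 < ε) (r : ℕ) :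
    ∃ N : ℕ, ∀ n m : ℕ, N ≤ n → m + r = n →
      (c + 1) * (((n + 1 : ℕ) - m : ℝ) + Real.log ((n + 1 : ℕ) / c)) ≤ ε * (n + 1 : ℕ) := by
  have h1 : (fun x : ℝ => (c + 1) * ((r + 1 : ℝ) - Real.log c + Real.log x)) =o[Filter.atTop]
      (fun x : ℝ => x) :=
    (((Asymptotics.isLittleO_const_id_atTop _).add Real.isLittleO_log_id_atTop)).const_mul_left _
  have h2 := (h1.bound hε).and (Filter.eventually_gt_atTop 0)
  obtain ⟨N, hN⟩ := Filter.eventually_atTop.1 (tendsto_natCast_atTop_atTop.eventually h2)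
  refine ⟨N, fun n m hn hmr => ?_⟩
  obtain ⟨h, hpos⟩ := hN (n + 1) (by omega)
  rw [Real.norm_eq_abs, Real.norm_eq_abs, abs_of_pos hpos] at h
  refine le_trans (le_of_eq ?_) ((le_abs_self _).trans h)
  rw [Real.log_div hpos.ne' hc.ne', ← hmr]
  push_cast; ring

/-! ### I.i.d. instances built from levels -/

/-- `n` independent copies of `h U`, where `U` is uniform on the unit interval. -/
noncomputable def iidInstance (n : ℕ) (h : unitInterval → ℝ) (hm : Measurable h)
    (h0 : ∀ u, 0 ≤ h u) (C : ℝ) (hC : ∀ u, h u ≤ C) : ProphetInstance n where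
  Ω := Fin n → unitInterval
  mΩ := MeasurableSpace.pi
  P := Measure.pi fun _ => volume
  isProb := inferInstance
  X i ω := h (ω i)
  measurable_X i := hm.comp (measurable_pi_apply i)
  indep_X := iIndepFun_pi fun _ => hm.aemeasurable
  nonneg_X i ω := h0 _
  integrable_X i := Integrable.of_bound (hm.comp (measurable_pi_apply i)).aestronglyMeasurable C
    (.of_forall fun ω => by rw [Real.norm_of_nonneg (h0 _)]; exact hC _)

/-- The points of the unit interval below `p`. -/
def belowSet (p : ℝ) : Set unitInterval := {u | (u : ℝ) < p}

theorem measurableSet_belowSet (p : ℝ) : MeasurableSet (belowSet p) :=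
  measurableSet_lt measurable_subtype_coe measurable_const

theorem volume_real_belowSet {p : ℝ} (h0 : 0 ≤ p) (h1 : p ≤ 1) : volume.real (belowSet p) = p := by
  have : belowSet p = Set.Iio (⟨p, h0, h1⟩ : unitInterval) := by
    ext u; exact Subtype.coe_lt_coe (x := u) (y := ⟨p, h0, h1⟩)
  rw [this, measureReal_def, unitInterval.volume_Iio, ENNReal.toReal_ofReal h0]

theorem integrable_indicator_belowSet (p : ℝ) :
    Integrable ((belowSet p).indicator (1 : unitInterval → ℝ)) :=
  (integrable_const (1 : ℝ)).indicator (measurableSet_belowSet p)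

theorem integral_indicator_belowSet {p : ℝ} (h0 : 0 ≤ p) (h1 : p ≤ 1) :
    ∫ u, (belowSet p).indicator (1 : unitInterval → ℝ) u = p := by
  rw [integral_indicator_one (measurableSet_belowSet p), volume_real_belowSet h0 h1]

theorem pi_real_exists_mem_belowSet {n : ℕ} (S : Finset (Fin n)) {p : ℝ} (h0 : 0 ≤ p)
    (h1 : p ≤ 1) :
    (Measure.pi fun _ : Fin n => (volume : Measure unitInterval)).real
      {ω | ∃ i ∈ S, ω i ∈ belowSet p} = 1 - (1 - p) ^ S.card := by
  classical
  have hc : {ω : Fin n → unitInterval | ∃ i ∈ S, ω i ∈ belowSet p} =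
      (Set.univ.pi fun i => if i ∈ S then (belowSet p)ᶜ else Set.univ)ᶜ := by
    ext ω
    simp only [Set.mem_ofPred_eq, Set.mem_compl_iff, Set.mem_univ_pi, not_forall]
    refine exists_congr fun i => ?_
    by_cases hi : i ∈ S <;> simp [hi]
  rw [hc, probReal_compl_eq_one_sub]
  · congr 1
    rw [measureReal_def, Measure.pi_pi, ENNReal.toReal_prod]
    calc ∏ i, (volume (if i ∈ S then (belowSet p)ᶜ else Set.univ)).toReal
        = ∏ i, if i ∈ S then 1 - p else 1 := by
          refine Finset.prod_congr rfl fun i _ => ?_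
          split_ifs
          · rw [← measureReal_def, probReal_compl_eq_one_sub (measurableSet_belowSet p),
              volume_real_belowSet h0 h1]
          · simp
      _ = (1 - p) ^ S.card := by
          rw [Finset.prod_ite_mem, Finset.univ_inter, Finset.prod_const]
  · refine MeasurableSet.univ_pi fun i => ?_
    split_ifs
    · exact (measurableSet_belowSet p).compl
    · exact MeasurableSet.univ

/-- The value `∑ k, a k * 1{u < p k}` of a finite family of rewards `a k`, each of which is
collected below its own level `p k`. -/
noncomputable def levelValue (n : ℕ) (a p : ℕ → ℝ) (u : unitInterval) : ℝ :=
  ∑ k ∈ Finset.range n, a k * (belowSet (p k)).indicator 1 u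

theorem measurable_levelValue (n : ℕ) (a p : ℕ → ℝ) : Measurable (levelValue n a p) :=
  Finset.measurable_sum _ fun k _ =>
    (measurable_one.indicator (measurableSet_belowSet (p k))).const_mul (a k)

theorem levelValue_nonneg {n : ℕ} {a : ℕ → ℝ} (ha : ∀ k < n, 0 ≤ a k) (p : ℕ → ℝ)
    (u : unitInterval) : 0 ≤ levelValue n a p u :=
  Finset.sum_nonneg fun k hk => mul_nonneg (ha k (Finset.mem_range.1 hk))
    (Set.indicator_nonneg (fun _ _ => zero_le_one) u)

theorem levelValue_le {n : ℕ} {a : ℕ → ℝ} (ha : ∀ k < n, 0 ≤ a k) (p : ℕ → ℝ)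
    (u : unitInterval) : levelValue n a p u ≤ ∑ k ∈ Finset.range n, a k :=
  Finset.sum_le_sum fun k hk => mul_le_of_le_one_right (ha k (Finset.mem_range.1 hk))
    (Set.indicator_le_self' (f := 1) (fun _ _ => zero_le_one) u)

/-- The instance made of `n` independent copies of a level value with `l` levels. -/
noncomputable def levelInstance (n l : ℕ) (a p : ℕ → ℝ) (ha : ∀ k < l, 0 ≤ a k) :
    ProphetInstance n :=
  iidInstance n (levelValue l a p) (measurable_levelValue l a p) (levelValue_nonneg ha p)
    (∑ k ∈ Finset.range l, a k) (levelValue_le ha p)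

theorem integral_excess_levelInstance_le {n l : ℕ} {a p : ℕ → ℝ} (ha : ∀ k < l, 0 ≤ a k)
    (hp : ∀ k < l, 0 ≤ p k ∧ p k ≤ 1) (i : Fin n) {j : ℕ} (hj : j ≤ l) :
    ∫ ω, max ((levelInstance n l a p ha).X i ω - ∑ k ∈ Finset.range j, a k) 0
        ∂(levelInstance n l a p ha).P ≤ ∑ k ∈ Finset.Ico j l, a k * p k := by
  set v := ∑ k ∈ Finset.range j, a k with hv
  have hmax : Measurable fun u => max (levelValue l a p u - v) 0 :=
    ((measurable_levelValue l a p).sub_const v).max measurable_const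
  have h1 : ∫ ω, max ((levelInstance n l a p ha).X i ω - v) 0 ∂(levelInstance n l a p ha).P =
      ∫ u, max (levelValue l a p u - v) 0 := by
    have hmp := measurePreserving_eval (fun _ : Fin n => (volume : Measure unitInterval)) i
    rw [← hmp.map_eq, integral_map hmp.measurable.aemeasurable hmax.aestronglyMeasurable]
    rfl
  have hnn : ∀ k < l, ∀ u, 0 ≤ a k * (belowSet (p k)).indicator (1 : unitInterval → ℝ) u :=
    fun k hk u => mul_nonneg (ha k hk) (Set.indicator_nonneg (fun _ _ => zero_le_one) u)
  have hint : ∀ k ∈ Finset.Ico j l,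
      Integrable fun u => a k * (belowSet (p k)).indicator (1 : unitInterval → ℝ) u :=
    fun k _ => (integrable_indicator_belowSet (p k)).const_mul _
  rw [h1]
  calc ∫ u, max (levelValue l a p u - v) 0
      ≤ ∫ u, ∑ k ∈ Finset.Ico j l, a k * (belowSet (p k)).indicator (1 : unitInterval → ℝ) u := by
        refine integral_mono_of_nonneg (.of_forall fun u => le_max_right _ _)
          (integrable_finsetSum _ hint) (.of_forall fun u => max_le ?_ ?_)
        -- The first `j` levels together pay at most the threshold, so only the later ones
        -- contribute to the excess.
        · have h2 := levelValue_le (n := j) (fun k hk => ha k (hk.trans_le hj)) p u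
          rw [levelValue, ← Finset.sum_range_add_sum_Ico _ hj]
          rw [levelValue] at h2
          linarith
        · exact Finset.sum_nonneg fun k hk => hnn k (Finset.mem_Ico.1 hk).2 u
    _ = ∑ k ∈ Finset.Ico j l, a k * p k := by
        rw [integral_finsetSum _ hint]
        refine Finset.sum_congr rfl fun k hk => ?_
        have := hp k (Finset.mem_Ico.1 hk).2
        rw [integral_const_mul, integral_indicator_belowSet this.1 this.2]

theorem le_MAX_levelInstance {n l : ℕ} {a p : ℕ → ℝ} (ha : ∀ k < l, 0 ≤ a k)
    (hp : ∀ k < l, 0 ≤ p k ∧ p k ≤ 1) (S : Finset (Fin n)) (hS : S.Nonempty) :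
    ∑ k ∈ Finset.range l, a k * (1 - (1 - p k) ^ S.card) ≤
      (levelInstance n l a p ha).MAX S := by
  set P := Measure.pi fun _ : Fin n => (volume : Measure unitInterval) with hP
  set E : ℕ → Set (Fin n → unitInterval) := fun k => {ω | ∃ i ∈ S, ω i ∈ belowSet (p k)} with hE
  have hEm : ∀ k, MeasurableSet (E k) := by
    intro k
    have : E k = ⋃ i ∈ S, (fun ω : Fin n → unitInterval => ω i) ⁻¹' belowSet (p k) := by
      ext ω; simp [hE]
    rw [this]
    exact Finset.measurableSet_biUnion _ fun i _ =>
      measurable_pi_apply i (measurableSet_belowSet (p k))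
  have hint : ∀ k ∈ Finset.range l,
      Integrable (fun ω => a k * (E k).indicator (1 : (Fin n → unitInterval) → ℝ) ω) P :=
    fun k _ => ((integrable_const (1 : ℝ)).indicator (hEm k)).const_mul _
  have hbdd : ∀ ω : Fin n → unitInterval,
      BddAbove (Set.range fun i : S => levelValue l a p (ω i)) :=
    fun ω => (Set.finite_range _).bddAbove
  have hsup : Integrable (fun ω => ⨆ i : S, levelValue l a p (ω i)) P := by
    refine Integrable.of_bound (Measurable.iSup fun i : S =>
      (measurable_levelValue l a p).comp (measurable_pi_apply (i : Fin n))).aestronglyMeasurable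
      (∑ k ∈ Finset.range l, a k) (.of_forall fun ω => ?_)
    rw [Real.norm_of_nonneg (Real.iSup_nonneg fun i => levelValue_nonneg ha p _)]
    exact Real.iSup_le (fun i => levelValue_le ha p _)
      (Finset.sum_nonneg fun k hk => ha k (Finset.mem_range.1 hk))
  calc ∑ k ∈ Finset.range l, a k * (1 - (1 - p k) ^ S.card)
      = ∫ ω, ∑ k ∈ Finset.range l, a k * (E k).indicator (1 : (Fin n → unitInterval) → ℝ) ω ∂P := by
        rw [integral_finsetSum _ hint]
        refine Finset.sum_congr rfl fun k hk => ?_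
        have := hp k (Finset.mem_range.1 hk)
        rw [integral_const_mul, integral_indicator_one (hEm k),
          pi_real_exists_mem_belowSet S this.1 this.2]
    _ ≤ ∫ ω, ⨆ i : S, levelValue l a p (ω i) ∂P := by
        refine integral_mono (integrable_finsetSum _ hint) hsup fun ω => ?_
        -- The levels are nested lower sets: the box with the least `ω i` lies below every `p k`
        -- that some box of `S` lies below.
        obtain ⟨i, hiS, hi⟩ := S.exists_min_image (fun i => (ω i : ℝ)) hS
        refine le_trans ?_ (le_ciSup (hbdd ω) ⟨i, hiS⟩)
        refine Finset.sum_le_sum fun k hk =>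
          mul_le_mul_of_nonneg_left ?_ (ha k (Finset.mem_range.1 hk))
        by_cases hω : ω ∈ E k
        · obtain ⟨j, hj, hlt⟩ := hω
          have : ω i ∈ belowSet (p k) := (hi j hj).trans_lt hlt
          rw [Set.indicator_of_mem this]
          exact Set.indicator_le_self' (f := 1) (fun _ _ => zero_le_one) ω
        · rw [Set.indicator_of_notMem hω]
          exact Set.indicator_nonneg (fun _ _ => zero_le_one) _

theorem sum_Ico_prodWeight_mul {q : ℕ → ℝ} {j n : ℕ} (h : j ≤ n) :
    ∑ k ∈ Finset.Ico j n, prodWeight q k * (1 - q k) = prodWeight q j - prodWeight q n := by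
  have h1 : ∀ k ∈ Finset.Ico j n, prodWeight q k * (1 - q k) =
      -(prodWeight q (k + 1) - prodWeight q k) := fun k _ => by rw [prodWeight_succ]; ring
  rw [Finset.sum_congr rfl h1, Finset.sum_neg_distrib, Finset.sum_Ico_sub _ h]
  ring

/-- A reward `1 / δ` collected with probability `δ` by each of `m` boxes is worth almost `m`. -/
theorem sub_le_one_sub_pow_div {δ : ℝ} (h0 : 0 < δ) (h1 : δ ≤ 1) (m : ℕ) :
    m - m ^ 2 * δ ≤ (1 - (1 - δ) ^ m) / δ := by
  rw [le_div_iff₀ h0]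
  have hgeom := mul_neg_geom_sum (1 - δ) m
  rw [sub_sub_cancel] at hgeom
  rw [← hgeom, mul_comm]
  refine mul_le_mul_of_nonneg_left ?_ h0.le
  have hterm : ∀ i ∈ Finset.range m, 1 - m * δ ≤ (1 - δ) ^ i := by
    intro i hi
    have hb := one_add_mul_le_pow (a := -δ) (by linarith) i
    rw [← sub_eq_add_neg] at hb
    have hi' : (i : ℝ) ≤ m := by exact_mod_cast (Finset.mem_range.1 hi).le
    nlinarith
  have := Finset.sum_le_sum hterm
  simp only [Finset.sum_const, Finset.card_range, nsmul_eq_mul] at this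
  nlinarith

/-! ### The hard instance and the conclusion -/

/-- An i.i.d. instance whose dynamic program takes the values `∑ k < j, w k`, where
`w = prodWeight q`. -/
theorem exists_instance_of_weights {n m : ℕ} (hm : 0 < m) (q : ℕ → ℝ)
    (hq : ∀ k < n, 0 ≤ q k ∧ q k ≤ 1) {ε : ℝ} (hε : 0 < ε) :
    ∃ I : ProphetInstance n, I.OPT ≤ ∑ k ∈ Finset.range n, prodWeight q k ∧
      ∀ S : Finset (Fin n), S.card = m →
        ∑ k ∈ Finset.range n, prodWeight q k * (1 - q k ^ m) + m * prodWeight q n - ε ≤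
          I.MAX S := by
  have hm' : (0 : ℝ) < m := by exact_mod_cast hm
  -- The jackpot loses at most `w n * m ^ 2 * δ ≤ ε` against its ideal value `m * w n`.
  set δ : ℝ := min 1 (ε / m ^ 2) with hδ
  have hδ0 : 0 < δ := lt_min one_pos (by positivity)
  have hδ1 : δ ≤ 1 := min_le_left _ _
  have hδε : m ^ 2 * δ ≤ ε := by
    have := min_le_right 1 (ε / (m : ℝ) ^ 2)
    rw [le_div_iff₀ (by positivity)] at this
    linarith
  set w := prodWeight q with hw
  have hw0 : ∀ k ≤ n, 0 ≤ w k := fun k hk =>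
    prodWeight_nonneg fun i hi => (hq i (by omega)).1
  have hwn1 : w n ≤ 1 := prodWeight_le_one (fun i hi => (hq i hi).1) fun i hi => (hq i hi).2
  -- Index `n` is the jackpot; its mean per box is `w n / δ * δ = w n`, whatever `δ` is.
  set a : ℕ → ℝ := fun k => if k < n then w k else w n / δ with hadef
  set p : ℕ → ℝ := fun k => if k < n then 1 - q k else δ with hpdef
  have ha : ∀ k < n + 1, 0 ≤ a k := by
    intro k hk
    simp only [hadef]
    split_ifs
    · exact hw0 k (by omega)
    · exact div_nonneg (hw0 n le_rfl) hδ0.le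
  have hp : ∀ k < n + 1, 0 ≤ p k ∧ p k ≤ 1 := by
    intro k hk
    simp only [hpdef]
    split_ifs with h
    · have := hq k h; constructor <;> linarith
    · exact ⟨hδ0.le, hδ1⟩
  have han : a n = w n / δ := by simp [hadef]
  have hpn : p n = δ := by simp [hpdef]
  have hak : ∀ k < n, a k = w k := fun k hk => by simp [hadef, hk]
  have hpk : ∀ k < n, p k = 1 - q k := fun k hk => by simp [hpdef, hk]
  have hsum : ∀ j ≤ n, ∑ k ∈ Finset.range j, w k = ∑ k ∈ Finset.range j, a k := fun j hj =>
    Finset.sum_congr rfl fun k hk => (hak k ((Finset.mem_range.1 hk).trans_le hj)).symm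
  refine ⟨levelInstance n (n + 1) a p ha, ?_, ?_⟩
  · refine ProphetInstance.OPT_le _ (fun j => ∑ k ∈ Finset.range j, w k) (by simp)
      (Finset.sum_nonneg fun k hk => hw0 k (Finset.mem_range.1 hk).le) fun i j hj => ?_
    rw [hsum j hj.le]
    refine (integral_excess_levelInstance_le ha hp i (by omega)).trans_eq ?_
    rw [← hsum j hj.le, Finset.sum_range_succ_sub_sum, Finset.sum_Ico_succ_top hj.le, han, hpn,
      div_mul_cancel₀ _ hδ0.ne']
    have : ∀ k ∈ Finset.Ico j n, a k * p k = w k * (1 - q k) := fun k hk => by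
      rw [hak k (Finset.mem_Ico.1 hk).2, hpk k (Finset.mem_Ico.1 hk).2]
    rw [Finset.sum_congr rfl this, sum_Ico_prodWeight_mul hj.le]
    ring
  · intro S hS
    refine le_trans ?_ (le_MAX_levelInstance ha hp S (Finset.card_pos.1 (hS ▸ hm)))
    rw [hS, Finset.sum_range_succ, han, hpn]
    have : ∀ k ∈ Finset.range n, a k * (1 - (1 - p k) ^ m) = w k * (1 - q k ^ m) := fun k hk => by
      rw [hak k (Finset.mem_range.1 hk), hpk k (Finset.mem_range.1 hk), sub_sub_cancel]
    rw [Finset.sum_congr rfl this, div_mul_eq_mul_div, ← mul_div_assoc']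
    have h1 := mul_le_mul_of_nonneg_left (sub_le_one_sub_pow_div hδ0 hδ1 m) (hw0 n le_rfl)
    have h2 : w n * (m ^ 2 * δ) ≤ ε := by
      have : 0 ≤ (m : ℝ) ^ 2 * δ := by positivity
      nlinarith
    linarith

theorem lemma4p5 (β : ℝ) (hβ : IsKertzBound β) (α : ℝ) (hα : β < α) (r : ℕ) (hr : 0 < r) :
    ∃ N : ℕ, ∀ n : ℕ, N ≤ n →
      ∃ I : ProphetInstance n,
        ∀ S : Finset (Fin n), S.card + r = n → I.OPT < α * I.MAX S := by
  obtain ⟨hβ0, hβ1, hint⟩ := hβ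
  have hα0 : 0 < α := hβ0.trans hα
  have hc : 0 < β⁻¹ - 1 := sub_pos.2 ((one_lt_inv₀ hβ0).2 hβ1)
  set ε : ℝ := (β⁻¹ - α⁻¹) / 4 with hεdef
  have hε : 0 < ε := by
    have := inv_strictAnti₀ hβ0 hα
    rw [hεdef]; linarith
  obtain ⟨N, hN⟩ := eventually_kertz_error (β⁻¹ - 1) ε hc hε r
  refine ⟨max N (r + 1), fun n hn => ?_⟩
  have hrn : r + 1 ≤ n := (le_max_right _ _).trans hn
  obtain ⟨m, rfl⟩ : ∃ m, n = m + r := ⟨n - r, by omega⟩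
  have hm : 0 < m := by omega
  obtain ⟨q, hq, hsum⟩ := exists_kertz_weights hc hint hm (Nat.le_add_right m r)
    (hN (m + r) m ((le_max_left _ _).trans hn) rfl)
  obtain ⟨I, hOPT, hMAX⟩ := exists_instance_of_weights hm q hq hε
  refine ⟨I, fun S hS => hOPT.trans_lt ?_⟩
  set V := ∑ k ∈ Finset.range (m + r), prodWeight q k with hV
  -- Since `V ≥ 1`, the additive loss `ε` is at most `ε * V`. In total `MAX ≥ (β⁻¹ - 2 * ε) * V`,
  -- which exceeds `α⁻¹ * V = (β⁻¹ - 4 * ε) * V`.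
  have hV1 : 1 ≤ V := by
    have := Finset.single_le_sum (f := prodWeight q) (fun k hk =>
      prodWeight_nonneg fun i hi => (hq i (hi.trans (Finset.mem_range.1 hk))).1)
      (Finset.mem_range.2 (by omega : 0 < m + r))
    rwa [prodWeight_zero] at this
  have h1 := hMAX S (by omega)
  have h2 : α⁻¹ * V < I.MAX S := by
    have : α⁻¹ = β⁻¹ - 4 * ε := by rw [hεdef]; ring
    rw [this]
    nlinarith
  calc V = α * (α⁻¹ * V) := by field_simp
    _ < α * I.MAX S := by gcongr
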